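/- Let $r\ge 3$ be an integer. For each integer $n\ge 2$ let $X^{(n)}_1,\dots,X^{(n)}_r$ be independent random variables, each uniformly distributed on $\{1,2,\dots,n\}$. For $s>0$ let $\Omega_r(s)$ be the volume of $\{(x_1,\dots,x_r)\in[0,1]^r : x_1\cdots x_r\le s\}$, let $\zeta$ be the Riemann zeta function, and let $$T_r=\prod_{p\ \mathrm{prime}}\Big(1-\frac1p\Big)^{r-1}\Big(1+\frac{r-1}{p}\Big).$$ Then this product converges and, for every real $t$ with $0<t\le 1$, the series below converge and $$\liminf_{n\to\infty}\mathbf P\big(\operatorname{lcm}(X^{(n)}_1,\dots,X^{(n)}_r)\le t\,n^r\big)\ \ge\ 1-\frac1{\zeta(r)}\sum_{j=1}^\infty\frac{1-\Omega_r(t\,j^{r-1})}{j^r},$$ $$\limsup_{n\to\infty}\mathbf P\big(\operatorname{lcm}(X^{(n)}_1,\dots,X^{(n)}_r)\le t\,n^r\big)\ \le\ 1-T_r\sum_{j=1}^\infty\frac{1-\Omega_r(t\,j^{r-1})}{j^r}.$$ -/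

import Mathlib

open MeasureTheory ProbabilityTheory Filter

/-- The part `0 ≤ x₁, …, x_r ≤ 1`, `x₁ ⋯ x_r ≤ s` of the unit cube of `ℝ^r`. -/
def hyperbolicRegion (r : ℕ) (s : ℝ) : Set (Fin r → ℝ) :=
  {x | (∀ i, 0 ≤ x i ∧ x i ≤ 1) ∧ ∏ i, x i ≤ s}

/-- `Ω_r(s)`: the (Lebesgue) volume of the region `hyperbolicRegion r s`. -/
noncomputable def OmegaVol (r : ℕ) (s : ℝ) : ℝ :=
  volume.real (hyperbolicRegion r s)

/-- The Euler factor at `p` of the constant `T_r`. -/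
noncomputable def coprimeFactor (r : ℕ) (p : Nat.Primes) : ℝ :=
  (1 - 1 / ((p : ℕ) : ℝ)) ^ (r - 1) * (1 + ((r : ℝ) - 1) / ((p : ℕ) : ℝ))

/-- `T_r = ∏_p (1 - 1/p)^(r-1) (1 + (r-1)/p)`, over all primes `p`. -/
noncomputable def coprimeConst (r : ℕ) : ℝ :=
  ∏' p : Nat.Primes, coprimeFactor r p

/-- The `j`-th term, `j ≥ 1`, of the series in the two bounds:
`(1 - Ω_r(t j^(r-1))) / j^r`. -/
noncomputable def boundTerm (r : ℕ) (t : ℝ) (j : ℕ+) : ℝ :=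
  (1 - OmegaVol r (t * ((j : ℕ) : ℝ) ^ (r - 1))) / ((j : ℕ) : ℝ) ^ r

/-- The event `lcm(X₁, …, X_r) ≤ t n^r`. -/
def lcmEvent {S : Type*} {r : ℕ} (X : Fin r → S → ℕ) (t : ℝ) (n : ℕ) : Set S :=
  {ω | ((Finset.univ.lcm (fun i => X i ω) : ℕ) : ℝ) ≤ t * (n : ℝ) ^ r}

/-! The probability that the lcm exceeds `t n^r` is a lattice point count divided by `n^r`. Write a
tuple as `x = j y` with `j` its gcd, so that `gcd y = 1`. Then `lcm x = j lcm y ≤ j ∏ y i`, with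
equality when the `y i` are pairwise coprime. A large lcm therefore forces `j ∏ y i > t n^r` for
some `y` with gcd 1 (`card_largeLcm_le`), and conversely every pairwise coprime `y` with this
property gives a large lcm (`le_card_largeLcm`).

The inequality says that the point `j y / n` has coordinate product above `t j^(r-1)`. The
corresponding region of the cube is convex, so these `y` have density `boundTerm r t j`. They are
equidistributed modulo every fixed `M`, so by the Chinese remainder theorem conditions at finitely
many primes multiply this density by a product of local factors
(`tendsto_card_largeMultiples_filter_primes`). The factors for "gcd 1" tend to `1/ζ(r)`, those for
"pairwise coprime" to `T_r`.

Only primes up to `w` are handled at first. For gcd 1 this truncation only enlarges the count, the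
useful direction. For pairwise coprimality the tuples lost to larger primes number at most `r^2 n^r
/ w` (`card_box_common_large_prime_le`). In both cases `n → ∞` precedes `w → ∞`. Only finitely many
`j` matter, since the region is empty once `t j^(r-1) ≥ 1`. -/

/-! ### The region of the cube above the hyperbolic surface -/

/-- The part of the unit cube of `ℝ^r` on which the product of the coordinates exceeds `s`. -/
def cubeAbove (r : ℕ) (s : ℝ) : Set (Fin r → ℝ) :=
  {x | (∀ i, 0 ≤ x i ∧ x i ≤ 1) ∧ s < ∏ i, x i}

theorem measurableSet_unitCube (r : ℕ) :
    MeasurableSet {x : Fin r → ℝ | ∀ i, 0 ≤ x i ∧ x i ≤ 1} := by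
  have : {x : Fin r → ℝ | ∀ i, 0 ≤ x i ∧ x i ≤ 1} = Set.Icc 0 1 := by
    ext x; simp [Pi.le_def, forall_and]
  rw [this]; exact measurableSet_Icc

theorem volume_unitCube (r : ℕ) :
    volume {x : Fin r → ℝ | ∀ i, 0 ≤ x i ∧ x i ≤ 1} = 1 := by
  have : {x : Fin r → ℝ | ∀ i, 0 ≤ x i ∧ x i ≤ 1} = Set.Icc 0 1 := by
    ext x; simp [Pi.le_def, forall_and]
  rw [this, Real.volume_Icc_pi]; simp

theorem measurableSet_cubeAbove (r : ℕ) (s : ℝ) : MeasurableSet (cubeAbove r s) :=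
  (measurableSet_unitCube r).inter
    (measurableSet_lt measurable_const
      (Finset.measurable_fun_prod _ fun i _ => measurable_pi_apply i))

theorem volume_cubeAbove (r : ℕ) (s : ℝ) :
    volume.real (cubeAbove r s) = 1 - OmegaVol r s := by
  have hsub : hyperbolicRegion r s ⊆ {x : Fin r → ℝ | ∀ i, 0 ≤ x i ∧ x i ≤ 1} := fun x hx => hx.1
  have hmeas : MeasurableSet (hyperbolicRegion r s) :=
    (measurableSet_unitCube r).inter
      (measurableSet_le (Finset.measurable_fun_prod _ fun i _ => measurable_pi_apply i)
        measurable_const)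
  have heq : cubeAbove r s
      = {x : Fin r → ℝ | ∀ i, 0 ≤ x i ∧ x i ≤ 1} \ hyperbolicRegion r s := by
    ext x
    simp only [cubeAbove, hyperbolicRegion, Set.mem_ofPred_eq, Set.mem_sdiff, not_and, not_le]
    tauto
  rw [heq, measureReal_sdiff hsub hmeas (by simp [volume_unitCube]), OmegaVol]
  simp [measureReal_def, volume_unitCube]

theorem isBounded_cubeAbove (r : ℕ) (s : ℝ) : Bornology.IsBounded (cubeAbove r s) := by
  refine (Metric.isBounded_Icc (0 : Fin r → ℝ) 1).subset fun x hx => ?_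
  exact ⟨fun i => (hx.1 i).1, fun i => (hx.1 i).2⟩

/-- Weighted AM-GM in each coordinate makes the product log-concave. Convexity is wanted because it
makes the frontier null, as lattice point counting requires. -/
theorem convex_cubeAbove (r : ℕ) {s : ℝ} (hs : 0 < s) : Convex ℝ (cubeAbove r s) := by
  intro x hx y hy a b ha hb hab
  refine ⟨fun i => ?_, ?_⟩
  · have hx0 := hx.1 i
    have hy0 := hy.1 i
    simp only [Pi.add_apply, Pi.smul_apply, smul_eq_mul]
    constructor
    · exact add_nonneg (mul_nonneg ha hx0.1) (mul_nonneg hb hy0.1)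
    · nlinarith [hx0.2, hy0.2]
  · have hm : 0 < min (∏ i, x i) (∏ i, y i) := lt_min (hs.trans hx.2) (hs.trans hy.2)
    calc s < min (∏ i, x i) (∏ i, y i) := lt_min hx.2 hy.2
      _ = (min (∏ i, x i) (∏ i, y i)) ^ a * (min (∏ i, x i) (∏ i, y i)) ^ b := by
        rw [← Real.rpow_add hm, hab, Real.rpow_one]
      _ ≤ (∏ i, x i) ^ a * (∏ i, y i) ^ b := by
        have hx0 : 0 ≤ ∏ i, x i := (hs.trans hx.2).le
        exact mul_le_mul (Real.rpow_le_rpow hm.le (min_le_left _ _) ha)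
          (Real.rpow_le_rpow hm.le (min_le_right _ _) hb) (Real.rpow_nonneg hm.le _)
          (Real.rpow_nonneg hx0 _)
      _ = ∏ i, (x i ^ a * y i ^ b) := by
        rw [← Real.finsetProd_rpow _ _ fun i _ => (hx.1 i).1,
          ← Real.finsetProd_rpow _ _ fun i _ => (hy.1 i).1, Finset.prod_mul_distrib]
      _ ≤ ∏ i, (a • x + b • y) i := by
        refine Finset.prod_le_prod (fun i _ => ?_) fun i _ => ?_
        · exact mul_nonneg (Real.rpow_nonneg (hx.1 i).1 _) (Real.rpow_nonneg (hy.1 i).1 _)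
        · exact Real.geom_mean_le_arith_mean2_weighted ha hb (hx.1 i).1 (hy.1 i).1 hab

/-! ### Lattice points with large coordinate product -/

open Classical in
/-- The tuples `y` of positive integers such that the multiple `j • y` lies in `[1, n]^r` and
has coordinates with product greater than `s * n ^ r`. -/
noncomputable def largeMultiples (r j n : ℕ) (s : ℝ) : Finset (Fin r → ℕ) :=
  (Fintype.piFinset fun _ => Finset.Icc 1 n).filter fun y =>
    (∀ i, j * y i ≤ n) ∧ s * (n : ℝ) ^ r < ∏ i, ((j * y i : ℕ) : ℝ)

theorem mem_largeMultiples {r j n : ℕ} {s : ℝ} {y : Fin r → ℕ} :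
    y ∈ largeMultiples r j n s ↔ (∀ i, 1 ≤ y i ∧ y i ≤ n) ∧ (∀ i, j * y i ≤ n) ∧
      s * (n : ℝ) ^ r < ∏ i, ((j * y i : ℕ) : ℝ) := by
  simp [largeMultiples]

/-- Division by `n` turns the tuples into the points of the lattice of mesh `1/n` in `cubeAbove r
s`. Points with a zero coordinate are excluded on both sides, as `s > 0`. -/
theorem tendsto_card_largeMultiples_one (r : ℕ) {s : ℝ} (hs : 0 < s) :
    Tendsto (fun n : ℕ => ((largeMultiples r 1 n s).card : ℝ) / (n : ℝ) ^ r) atTop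
      (nhds (1 - OmegaVol r s)) := by
  have h := tendsto_card_div_pow_atTop_volume (cubeAbove r s) (isBounded_cubeAbove r s)
    (measurableSet_cubeAbove r s) ((convex_cubeAbove r hs).addHaar_frontier volume)
  rw [volume_cubeAbove, Fintype.card_fin] at h
  refine h.congr' ?_
  filter_upwards [eventually_ge_atTop 1] with n hn
  have : NeZero n := ⟨by omega⟩
  have hn0 : (0 : ℝ) < n := by exact_mod_cast hn
  congr 2
  have hinj : Function.Injective (fun (y : Fin r → ℕ) (i : Fin r) => (y i : ℝ) / n) := by
    intro y z hyz
    ext i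
    have := congrFun hyz i
    simp only at this
    rw [div_left_inj' hn0.ne'] at this
    exact_mod_cast this
  rw [← Set.ncard_coe_finset, ← Set.ncard_image_of_injective _ hinj, ← Nat.card_coe_set_eq]
  congr 2
  ext x
  simp only [Set.mem_inter_iff, Set.mem_image, Finset.mem_coe, mem_largeMultiples]
  rw [← Submodule.coe_pointwise_smul, SetLike.mem_coe, BoxIntegral.unitPartition.mem_smul_span_iff]
  constructor
  · rintro ⟨⟨hx1, hx2⟩, hx3⟩
    have hpos : ∀ i, 0 < x i := by
      intro i
      refine (hx1 i).1.lt_of_ne fun h0 => ?_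
      rw [Finset.prod_eq_zero (Finset.mem_univ i) h0.symm] at hx2
      linarith
    choose z hz using hx3
    simp only [algebraMap_int_eq, eq_intCast] at hz
    have hzpos : ∀ i, 0 < z i := fun i => by
      have : (0 : ℝ) < z i := by rw [hz]; exact mul_pos hn0 (hpos i)
      exact_mod_cast this
    have hzle : ∀ i, z i ≤ n := fun i => by
      have : (z i : ℝ) ≤ n := by rw [hz]; nlinarith [(hx1 i).2]
      exact_mod_cast this
    have hcast : ∀ i, (((z i).toNat : ℕ) : ℝ) = n * x i := fun i => by
      rw [← hz]
      have : (((z i).toNat : ℕ) : ℤ) = z i := Int.toNat_of_nonneg (hzpos i).le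
      exact_mod_cast this
    refine ⟨fun i => (z i).toNat, ⟨fun i => ?_, fun i => ?_, ?_⟩, ?_⟩
    · have := hzpos i
      have := hzle i
      dsimp only
      omega
    · have := hzle i
      dsimp only
      omega
    · simp only [one_mul, hcast, Finset.prod_mul_distrib, Finset.prod_const, Finset.card_univ,
        Fintype.card_fin]
      rw [mul_comm]
      exact mul_lt_mul_of_pos_left hx2 (by positivity)
    · ext i
      simp only [hcast]
      field_simp
  · rintro ⟨y, ⟨hy1, -, hy3⟩, rfl⟩
    refine ⟨⟨fun i => ⟨by positivity, ?_⟩, ?_⟩, fun i => ⟨y i, ?_⟩⟩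
    · rw [div_le_one hn0]; exact_mod_cast (hy1 i).2
    · simp only [one_mul] at hy3
      rw [Finset.prod_div_distrib, Finset.prod_const, Finset.card_univ, Fintype.card_fin,
        lt_div_iff₀ (by positivity)]
      exact hy3
    · simp only [algebraMap_int_eq, eq_intCast, Int.cast_natCast]
      field_simp

/-! ### Elementary counts in the box -/

theorem card_box_filter_mem_le (r n : ℕ) (i : Fin r) (T : Finset ℕ) :
    (((Fintype.piFinset fun _ : Fin r => Finset.Icc 1 n)).filter fun y => y i ∈ T).card
      ≤ T.card * n ^ (r - 1) := by
  have hsub : ((Fintype.piFinset fun _ : Fin r => Finset.Icc 1 n)).filter (fun y => y i ∈ T)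
      ⊆ Fintype.piFinset (Function.update (fun _ : Fin r => Finset.Icc 1 n) i T) := by
    intro y hy
    simp only [Finset.mem_filter, Fintype.mem_piFinset] at hy ⊢
    intro k
    rcases eq_or_ne k i with rfl | hk
    · simpa using hy.2
    · simpa [hk] using hy.1 k
  refine (Finset.card_le_card hsub).trans_eq ?_
  rw [Fintype.card_piFinset, ← Finset.mul_prod_erase _ _ (Finset.mem_univ i)]
  rw [Function.update_self, Finset.prod_congr rfl (g := fun _ => n)]
  · rw [Finset.prod_const, Finset.card_erase_of_mem (Finset.mem_univ i), Finset.card_univ,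
      Fintype.card_fin]
  · intro k hk
    rw [Function.update_of_ne (Finset.ne_of_mem_erase hk), Nat.card_Icc, Nat.add_sub_cancel]

theorem card_box_filter_mem_mem_le (r n : ℕ) {i k : Fin r} (hik : i ≠ k) (T U : Finset ℕ) :
    (((Fintype.piFinset fun _ : Fin r => Finset.Icc 1 n)).filter
      fun y => y i ∈ T ∧ y k ∈ U).card ≤ T.card * (U.card * n ^ (r - 2)) := by
  have hsub : ((Fintype.piFinset fun _ : Fin r => Finset.Icc 1 n)).filter
      (fun y => y i ∈ T ∧ y k ∈ U)
      ⊆ Fintype.piFinset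
        (Function.update (Function.update (fun _ : Fin r => Finset.Icc 1 n) k U) i T) := by
    intro y hy
    simp only [Finset.mem_filter, Fintype.mem_piFinset] at hy ⊢
    intro l
    rcases eq_or_ne l i with rfl | hl
    · simpa using hy.2.1
    rcases eq_or_ne l k with rfl | hl'
    · simpa [hl] using hy.2.2
    · simpa [hl, hl'] using hy.1 l
  have hk : k ∈ Finset.univ.erase i := Finset.mem_erase.2 ⟨hik.symm, Finset.mem_univ k⟩
  refine (Finset.card_le_card hsub).trans_eq ?_
  rw [Fintype.card_piFinset, ← Finset.mul_prod_erase _ _ (Finset.mem_univ i),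
    ← Finset.mul_prod_erase _ _ hk, Function.update_self, Function.update_of_ne hik.symm,
    Function.update_self, Finset.prod_congr rfl (g := fun _ => n)]
  · rw [Finset.prod_const, Finset.card_erase_of_mem hk,
      Finset.card_erase_of_mem (Finset.mem_univ i), Finset.card_univ, Fintype.card_fin]
    rfl
  · intro l hl
    have h1 := Finset.ne_of_mem_erase hl
    have h2 := Finset.ne_of_mem_erase (Finset.mem_of_mem_erase hl)
    rw [Function.update_of_ne h2, Function.update_of_ne h1, Nat.card_Icc, Nat.add_sub_cancel]

/-- Few points of the box `[1, n]^r` have a coordinate that a shift by `M` moves past `n / j`. -/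
theorem card_box_boundary_le (r n M : ℕ) {j : ℕ} (hj : 0 < j) :
    (((Fintype.piFinset fun _ : Fin r => Finset.Icc 1 n)).filter
      fun y => ∃ i, j * y i ≤ n ∧ n < j * (y i + M)).card ≤ r * (M * n ^ (r - 1)) := by
  have hsub : ((Fintype.piFinset fun _ : Fin r => Finset.Icc 1 n)).filter
      (fun y => ∃ i, j * y i ≤ n ∧ n < j * (y i + M)) ⊆
      Finset.univ.biUnion fun i => ((Fintype.piFinset fun _ : Fin r => Finset.Icc 1 n)).filter
        fun y => y i ∈ Finset.Ioc (n / j - M) (n / j) := by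
    intro y hy
    simp only [Finset.mem_filter, Finset.mem_biUnion, Finset.mem_univ, true_and,
      Finset.mem_Ioc] at hy ⊢
    obtain ⟨hy, i, h1, h2⟩ := hy
    refine ⟨i, hy, ?_, (Nat.le_div_iff_mul_le hj).2 (by linarith)⟩
    have h3 : n / j < y i + M := (Nat.div_lt_iff_lt_mul hj).2 (by linarith)
    -- When `n / j < M` the subtraction truncates to 0, and `1 ≤ y i` is then needed.
    have h4 := (Fintype.mem_piFinset.1 hy) i
    rw [Finset.mem_Icc] at h4
    omega
  refine (Finset.card_le_card hsub).trans (Finset.card_biUnion_le.trans ?_)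
  calc ∑ i : Fin r, (((Fintype.piFinset fun _ : Fin r => Finset.Icc 1 n)).filter
        fun y => y i ∈ Finset.Ioc (n / j - M) (n / j)).card
      ≤ ∑ _i : Fin r, M * n ^ (r - 1) := by
        refine Finset.sum_le_sum fun i _ => (card_box_filter_mem_le r n i _).trans ?_
        gcongr
        rw [Nat.card_Ioc]; omega
    _ = r * (M * n ^ (r - 1)) := by simp

/-! ### Equidistribution in residue classes -/

open Classical in
/-- The tuples of `largeMultiples r j n s` in the residue class `a` modulo `M`. -/
noncomputable def largeMultiplesMod (r j n : ℕ) (s : ℝ) {M : ℕ} (a : Fin r → ZMod M) :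
    Finset (Fin r → ℕ) :=
  (largeMultiples r j n s).filter fun y => (fun i => (y i : ZMod M)) = a

/-- Translation by the least nonnegative representative of `b - a` maps class `a` injectively to
class `b` and only increases the product. A tuple can leave the set only when some coordinate passes
`n / j`, which happens near the boundary. -/
theorem card_largeMultiplesMod_le (r n : ℕ) {j : ℕ} (hj : 0 < j) (s : ℝ) {M : ℕ} [NeZero M]
    (a b : Fin r → ZMod M) :
    (largeMultiplesMod r j n s a).card
      ≤ (largeMultiplesMod r j n s b).card + r * (M * n ^ (r - 1)) := by
  classical
  set d : Fin r → ℕ := fun i => (b i - a i).val with hd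
  have hdlt : ∀ i, d i < M := fun i => ZMod.val_lt _
  rw [← Finset.card_filter_add_card_filter_not (s := largeMultiplesMod r j n s a)
    (p := fun y => y + d ∈ largeMultiplesMod r j n s b)]
  refine add_le_add ?_ (le_trans (Finset.card_le_card ?_) (card_box_boundary_le r n M hj))
  · refine Finset.card_le_card_of_injOn (fun y => y + d) (fun y hy => ?_)
      (fun y _ z _ h => add_right_cancel h)
    exact (Finset.mem_filter.1 hy).2
  · intro y hy
    obtain ⟨hy, hyd⟩ := Finset.mem_filter.1 hy
    obtain ⟨hy, hya⟩ := Finset.mem_filter.1 hy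
    obtain ⟨hy1, hy2, hy3⟩ := mem_largeMultiples.1 hy
    refine Finset.mem_filter.2 ⟨Fintype.mem_piFinset.2 fun i => Finset.mem_Icc.2 (hy1 i), ?_⟩
    by_contra! hcon
    refine hyd (Finset.mem_filter.2 ⟨mem_largeMultiples.2 ⟨fun i => ?_, fun i => ?_, ?_⟩, ?_⟩)
    · have h1 := hcon i (hy2 i)
      have h2 := hdlt i
      have h3 := hy1 i
      simp only [Pi.add_apply]
      refine ⟨by omega, le_trans ?_ h1⟩
      nlinarith
    · refine le_trans ?_ (hcon i (hy2 i))
      exact Nat.mul_le_mul_left _ (Nat.add_le_add_left (hdlt i).le _)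
    · refine hy3.trans_le (Finset.prod_le_prod (fun i _ => by positivity) fun i _ => ?_)
      have : j * y i ≤ j * (y + d) i := Nat.mul_le_mul_left _ (Nat.le_add_right _ _)
      exact_mod_cast this
    · funext i
      have := congrFun hya i
      simp only [Pi.add_apply, Nat.cast_add, hd, ZMod.natCast_val, ZMod.cast_id', id] at this ⊢
      rw [this]; ring

theorem card_largeMultiples_eq_sum (r j n : ℕ) (s : ℝ) {M : ℕ} [NeZero M] :
    (largeMultiples r j n s).card
      = ∑ a : Fin r → ZMod M, (largeMultiplesMod r j n s a).card := by
  classical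
  exact Finset.card_eq_sum_card_fiberwise fun _ _ => Finset.mem_coe.2 (Finset.mem_univ _)

/-- Any two classes have nearly equal counts, so each is close to the average over all `M ^ r`
classes. -/
theorem abs_card_largeMultiplesMod_sub_le (r n : ℕ) {j : ℕ} (hj : 0 < j) (s : ℝ) {M : ℕ}
    [NeZero M] (a : Fin r → ZMod M) :
    |((largeMultiplesMod r j n s a).card : ℝ)
      - ((largeMultiples r j n s).card : ℝ) / (M : ℝ) ^ r| ≤ r * (M * (n : ℝ) ^ (r - 1)) := by
  have hM : (0 : ℝ) < (M : ℝ) ^ r := by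
    have : 0 < M := NeZero.pos M
    positivity
  have hcard : ((Finset.univ : Finset (Fin r → ZMod M)).card : ℝ) = (M : ℝ) ^ r := by
    simp [Finset.card_univ, ZMod.card]
  have hdiff : ((largeMultiplesMod r j n s a).card : ℝ)
      - ((largeMultiples r j n s).card : ℝ) / (M : ℝ) ^ r
      = (∑ b : Fin r → ZMod M, (((largeMultiplesMod r j n s a).card : ℝ)
        - (largeMultiplesMod r j n s b).card)) / (M : ℝ) ^ r := by
    rw [Finset.sum_sub_distrib, Finset.sum_const, nsmul_eq_mul, hcard,
      card_largeMultiples_eq_sum r j n s (M := M)]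
    push_cast
    field_simp
  rw [hdiff, abs_div, abs_of_pos hM, div_le_iff₀ hM]
  refine (Finset.abs_sum_le_sum_abs _ _).trans ?_
  calc ∑ b : Fin r → ZMod M, |((largeMultiplesMod r j n s a).card : ℝ)
        - (largeMultiplesMod r j n s b).card|
      ≤ ∑ _b : Fin r → ZMod M, (r * (M * (n : ℝ) ^ (r - 1))) := by
        refine Finset.sum_le_sum fun b _ => abs_le.2 ⟨?_, ?_⟩
        · have h : ((largeMultiplesMod r j n s b).card : ℝ)
              ≤ (largeMultiplesMod r j n s a).card + r * (M * (n : ℝ) ^ (r - 1)) := by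
            exact_mod_cast card_largeMultiplesMod_le r n hj s b a
          linarith
        · have h : ((largeMultiplesMod r j n s a).card : ℝ)
              ≤ (largeMultiplesMod r j n s b).card + r * (M * (n : ℝ) ^ (r - 1)) := by
            exact_mod_cast card_largeMultiplesMod_le r n hj s a b
          linarith
    _ = r * (M * (n : ℝ) ^ (r - 1)) * (M : ℝ) ^ r := by
        rw [Finset.sum_const, nsmul_eq_mul, hcard, mul_comm]

/-- The total density `V` is left as a hypothesis because the lemma serves twice: with `j = 1` and
modulus `j` it yields the density of the multiples of `j`, then with that density it gives
equidistribution for general `j`. -/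
theorem tendsto_card_largeMultiplesMod_of_tendsto {r : ℕ} (hr : 0 < r) {j : ℕ} (hj : 0 < j)
    {s V : ℝ} (h : Tendsto (fun n : ℕ => ((largeMultiples r j n s).card : ℝ) / (n : ℝ) ^ r) atTop
      (nhds V)) {M : ℕ} [NeZero M] (a : Fin r → ZMod M) :
    Tendsto (fun n : ℕ => ((largeMultiplesMod r j n s a).card : ℝ) / (n : ℝ) ^ r) atTop
      (nhds (V / (M : ℝ) ^ r)) := by
  have hdiff : Tendsto (fun n : ℕ => ((largeMultiplesMod r j n s a).card : ℝ) / (n : ℝ) ^ r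
      - ((largeMultiples r j n s).card : ℝ) / (n : ℝ) ^ r / (M : ℝ) ^ r) atTop (nhds 0) := by
    refine squeeze_zero_norm' (a := fun n : ℕ => (r * M : ℝ) / n) ?_
      (tendsto_const_div_atTop_nhds_zero_nat _)
    filter_upwards [eventually_ge_atTop 1] with n hn
    have hn0 : (0 : ℝ) < n := by exact_mod_cast hn
    have hb := abs_card_largeMultiplesMod_sub_le r n hj s a
    rw [Real.norm_eq_abs, div_right_comm, ← sub_div, abs_div, abs_of_pos (pow_pos hn0 r),
      div_le_iff₀ (pow_pos hn0 r)]
    refine hb.trans_eq ?_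
    obtain ⟨m, rfl⟩ : ∃ m, r = m + 1 := ⟨r - 1, by omega⟩
    rw [Nat.add_sub_cancel, pow_succ]
    field_simp
  simpa using hdiff.add (h.div_const ((M : ℝ) ^ r))

theorem card_largeMultiples_eq (r n : ℕ) {j : ℕ} (hj : 0 < j) (s : ℝ) :
    (largeMultiples r j n s).card
      = (largeMultiplesMod r 1 n s (0 : Fin r → ZMod j)).card := by
  classical
  refine Finset.card_bij' (fun y _ => fun i => j * y i) (fun y _ => fun i => y i / j) ?_ ?_ ?_ ?_
  · intro y hy
    obtain ⟨h1, h2, h3⟩ := mem_largeMultiples.1 hy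
    refine Finset.mem_filter.2 ⟨mem_largeMultiples.2 ⟨fun i => ⟨?_, h2 i⟩, ?_, ?_⟩, ?_⟩
    · exact Nat.mul_pos hj (h1 i).1
    · simpa using h2
    · simpa using h3
    · funext i; simp
  · intro y hy
    obtain ⟨hy, hy0⟩ := Finset.mem_filter.1 hy
    obtain ⟨h1, h2, h3⟩ := mem_largeMultiples.1 hy
    have hdvd : ∀ i, j * (y i / j) = y i := fun i =>
      Nat.mul_div_cancel' ((ZMod.natCast_eq_zero_iff _ _).1 (congrFun hy0 i))
    refine mem_largeMultiples.2 ⟨fun i => ⟨?_, ?_⟩, fun i => ?_, ?_⟩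
    · refine Nat.pos_of_ne_zero fun h0 => ?_
      have h4 := hdvd i
      have h5 := (h1 i).1
      rw [h0, mul_zero] at h4
      omega
    · exact (Nat.div_le_self _ _).trans (h1 i).2
    · rw [hdvd]; exact (h1 i).2
    · simpa [hdvd] using h3
  · intro y _
    funext i
    exact Nat.mul_div_cancel_left _ hj
  · intro y hy
    obtain ⟨hy, hy0⟩ := Finset.mem_filter.1 hy
    funext i
    exact Nat.mul_div_cancel' ((ZMod.natCast_eq_zero_iff _ _).1 (congrFun hy0 i))

theorem tendsto_card_largeMultiples {r : ℕ} (hr : 0 < r) {j : ℕ} (hj : 0 < j) {s : ℝ}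
    (hs : 0 < s) :
    Tendsto (fun n : ℕ => ((largeMultiples r j n s).card : ℝ) / (n : ℝ) ^ r) atTop
      (nhds ((1 - OmegaVol r s) / (j : ℝ) ^ r)) := by
  have : NeZero j := ⟨hj.ne'⟩
  simp only [card_largeMultiples_eq r _ hj s]
  exact tendsto_card_largeMultiplesMod_of_tendsto hr one_pos
    (tendsto_card_largeMultiples_one r hs) _

open Classical in
theorem tendsto_card_largeMultiples_filter {r : ℕ} (hr : 0 < r) {j : ℕ} (hj : 0 < j) {s : ℝ}
    (hs : 0 < s) {M : ℕ} [NeZero M] (A : Finset (Fin r → ZMod M)) :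
    Tendsto (fun n : ℕ => (((largeMultiples r j n s).filter
        fun y => (fun i => (y i : ZMod M)) ∈ A).card : ℝ) / (n : ℝ) ^ r) atTop
      (nhds ((A.card : ℝ) / (M : ℝ) ^ r * ((1 - OmegaVol r s) / (j : ℝ) ^ r))) := by
  have hcard : ∀ n : ℕ, ((largeMultiples r j n s).filter
      fun y => (fun i => (y i : ZMod M)) ∈ A).card
      = ∑ a ∈ A, (largeMultiplesMod r j n s a).card := fun n => by
    refine (Finset.card_eq_sum_card_fiberwise (t := A) (f := fun (y : Fin r → ℕ) i => (y i : ZMod M))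
      fun y hy => (Finset.mem_filter.1 (Finset.mem_coe.1 hy)).2).trans
      (Finset.sum_congr rfl fun a ha => ?_)
    rw [Finset.filter_filter, largeMultiplesMod]
    congr 1
    refine Finset.filter_congr fun y _ => ⟨fun h => h.2, fun h => ⟨?_, h⟩⟩
    subst h
    exact ha
  have h := tendsto_finsetSum A fun a _ =>
    tendsto_card_largeMultiplesMod_of_tendsto hr hj (tendsto_card_largeMultiples hr hj hs) a
  rw [Finset.sum_const, nsmul_eq_mul] at h
  convert h using 2 with n
  · rw [hcard, Nat.cast_sum, Finset.sum_div]
  · ring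

/-! ### Independence of conditions at different primes -/

open Classical in
-- The Chinese remainder theorem in each coordinate, followed by exchanging the coordinate and prime
-- indices.
theorem card_filter_forall_castHom_mem {r : ℕ} {ι : Type*} [Fintype ι] (m : ι → ℕ)
    [NeZero (∏ p, m p)] (hm : Pairwise (Function.onFun Nat.Coprime m))
    (A : ∀ p, Finset (Fin r → ZMod (m p))) :
    (Finset.univ.filter fun a : Fin r → ZMod (∏ p, m p) => ∀ p,
      (fun i => ZMod.castHom (Finset.dvd_prod_of_mem m (Finset.mem_univ p)) (ZMod (m p)) (a i))
        ∈ A p).card = ∏ p, (A p).card := by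
  rw [← Fintype.card_piFinset]
  refine Finset.card_equiv
    (((Equiv.refl (Fin r)).arrowCongr (ZMod.prodEquivPi m hm).toEquiv).trans
      (Equiv.piComm fun _ p => ZMod (m p))) fun a => ?_
  simp only [Finset.mem_filter, Finset.mem_univ, true_and, Fintype.mem_piFinset]
  refine forall_congr' fun p => ?_
  have : (fun i => ZMod.castHom (Finset.dvd_prod_of_mem m (Finset.mem_univ p)) (ZMod (m p)) (a i))
      = (((Equiv.refl (Fin r)).arrowCongr (ZMod.prodEquivPi m hm).toEquiv).trans
      (Equiv.piComm fun _ p => ZMod (m p))) a p := by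
    funext i
    exact (ZMod.prodEquivPi_apply m hm (a i) p).symm
  rw [this]

open Classical in
/-- Local conditions at finitely many primes are independent, also of the size of the product. -/
theorem tendsto_card_largeMultiples_filter_primes {r : ℕ} (hr : 0 < r) {j : ℕ} (hj : 0 < j)
    {s : ℝ} (hs : 0 < s) (Q : Finset Nat.Primes)
    (A : ∀ p : Nat.Primes, Finset (Fin r → ZMod (p : ℕ))) :
    Tendsto (fun n : ℕ => (((largeMultiples r j n s).filter
        fun y => ∀ p ∈ Q, (fun i => (y i : ZMod (p : ℕ))) ∈ A p).card : ℝ) / (n : ℝ) ^ r) atTop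
      (nhds ((∏ p ∈ Q, ((A p).card : ℝ) / ((p : ℕ) : ℝ) ^ r)
        * ((1 - OmegaVol r s) / (j : ℝ) ^ r))) := by
  have hM : NeZero (∏ p : Q, ((p : Nat.Primes) : ℕ)) :=
    ⟨Finset.prod_ne_zero_iff.2 fun p _ => p.1.2.ne_zero⟩
  have hm : Pairwise (Function.onFun Nat.Coprime fun p : Q => ((p : Nat.Primes) : ℕ)) := by
    intro p q hpq
    refine (Nat.coprime_primes p.1.2 q.1.2).2 fun h => hpq ?_
    exact Subtype.ext (Subtype.ext h)
  have h := tendsto_card_largeMultiples_filter hr hj hs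
    (Finset.univ.filter fun a : Fin r → ZMod (∏ p : Q, ((p : Nat.Primes) : ℕ)) => ∀ p : Q,
      (fun i => ZMod.castHom (Finset.dvd_prod_of_mem (fun p : Q => ((p : Nat.Primes) : ℕ))
        (Finset.mem_univ p)) (ZMod ((p : Nat.Primes) : ℕ)) (a i)) ∈ A p)
  rw [card_filter_forall_castHom_mem (fun p : Q => ((p : Nat.Primes) : ℕ)) hm fun p => A p] at h
  convert h using 2 with n
  · congr 3
    refine Finset.filter_congr fun y _ => ?_
    rw [Finset.mem_filter]
    simp only [Finset.mem_univ, true_and, map_natCast, Subtype.forall]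
  · congr 1
    rw [Finset.prod_div_distrib, Finset.prod_pow]
    push_cast
    rw [Finset.prod_coe_sort Q fun p => ((A p).card : ℝ),
      Finset.prod_coe_sort Q fun p => ((p : ℕ) : ℝ)]

/-! ### Local densities -/

theorem card_ne_zero_residues (r : ℕ) (p : ℕ) [Fact p.Prime] :
    (Finset.univ.filter fun a : Fin r → ZMod p => a ≠ 0).card = p ^ r - 1 := by
  rw [Finset.filter_ne', Finset.card_erase_of_mem (Finset.mem_univ _), Finset.card_univ]
  simp [ZMod.card]

open Classical in
-- Either no coordinate vanishes, or exactly one does, in one of `r` positions.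
theorem card_pairwise_ne_zero_residues (r : ℕ) (p : ℕ) [Fact p.Prime] :
    (Finset.univ.filter fun a : Fin r → ZMod p => ∀ i k, i ≠ k → a i ≠ 0 ∨ a k ≠ 0).card
      = (p - 1) ^ r + r * (p - 1) ^ (r - 1) := by
  have hcard : ((Finset.univ : Finset (ZMod p)).erase 0).card = p - 1 := by
    rw [Finset.card_erase_of_mem (Finset.mem_univ _), Finset.card_univ, ZMod.card]
  set U : Finset (ZMod p) := Finset.univ.erase 0 with hU
  have hsplit : (Finset.univ.filter fun a : Fin r → ZMod p => ∀ i k, i ≠ k → a i ≠ 0 ∨ a k ≠ 0)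
      = (Fintype.piFinset fun _ : Fin r => U) ∪ Finset.univ.biUnion fun i : Fin r =>
        Fintype.piFinset (Function.update (fun _ : Fin r => U) i {0}) := by
    ext a
    simp only [Finset.mem_filter, Finset.mem_univ, true_and, Finset.mem_union,
      Fintype.mem_piFinset, Finset.mem_biUnion]
    constructor
    · intro h
      by_cases h0 : ∀ i, a i ≠ 0
      · left; intro i; simpa [hU] using h0 i
      · push Not at h0
        obtain ⟨i, hi⟩ := h0
        refine Or.inr ⟨i, fun k => ?_⟩
        rcases eq_or_ne k i with rfl | hk
        · simpa using hi
        · have := h i k hk.symm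
          simpa [hk, hU, hi] using this
    · rintro (h | ⟨l, h⟩) i k hik
      · left; simpa [hU] using h i
      · rcases eq_or_ne i l with rfl | hi
        · right; have := h k; simpa [hik.symm, hU] using this
        · left; have := h i; simpa [hi, hU] using this
  have hzero : ∀ (i : Fin r) (a : Fin r → ZMod p),
      a ∈ Fintype.piFinset (Function.update (fun _ : Fin r => U) i {0}) → a i = 0 := by
    intro i a ha
    simpa using (Fintype.mem_piFinset.1 ha) i
  rw [hsplit, Finset.card_union_of_disjoint, Finset.card_biUnion]
  · congr 1
    · rw [Fintype.card_piFinset, Finset.prod_const, Finset.card_univ, Fintype.card_fin, hcard]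
    · rw [Finset.sum_congr rfl (g := fun _ => (p - 1) ^ (r - 1))]
      · simp
      intro i _
      rw [Fintype.card_piFinset, ← Finset.mul_prod_erase _ _ (Finset.mem_univ i),
        Function.update_self, Finset.card_singleton, one_mul,
        Finset.prod_congr rfl (g := fun _ => p - 1)]
      · rw [Finset.prod_const, Finset.card_erase_of_mem (Finset.mem_univ i), Finset.card_univ,
          Fintype.card_fin]
      · intro k hk
        rw [Function.update_of_ne (Finset.ne_of_mem_erase hk), hcard]
  · intro i _ k _ hik
    refine Finset.disjoint_left.2 fun a ha hak => ?_
    have h1 := hzero k a hak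
    have h2 := (Fintype.mem_piFinset.1 ha) k
    rw [Function.update_of_ne hik.symm, h1, hU] at h2
    simp at h2
  · refine Finset.disjoint_left.2 fun a ha hak => ?_
    obtain ⟨i, -, hi⟩ := Finset.mem_biUnion.1 hak
    have h1 := hzero i a hi
    have h2 := (Fintype.mem_piFinset.1 ha) i
    rw [h1, hU] at h2
    simp at h2

open Classical in
theorem card_pairwise_ne_zero_residues_div {r : ℕ} (hr : 0 < r) (p : Nat.Primes)
    [Fact (p : ℕ).Prime] :
    ((Finset.univ.filter fun a : Fin r → ZMod (p : ℕ) =>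
      ∀ i k, i ≠ k → a i ≠ 0 ∨ a k ≠ 0).card : ℝ) / ((p : ℕ) : ℝ) ^ r = coprimeFactor r p := by
  have hp : (0 : ℝ) < ((p : ℕ) : ℝ) := by exact_mod_cast p.2.pos
  rw [card_pairwise_ne_zero_residues, coprimeFactor]
  obtain ⟨m, rfl⟩ : ∃ m, r = m + 1 := ⟨r - 1, by omega⟩
  push_cast [p.2.one_lt.le]
  simp only [pow_succ]
  have : (1 : ℝ) - 1 / ((p : ℕ) : ℝ) = (((p : ℕ) : ℝ) - 1) / ((p : ℕ) : ℝ) := by field_simp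
  rw [this, div_pow]
  field_simp
  ring

/-! ### From probability to counting -/

/-- By independence the joint law is a product of uniform laws, so each point of the box has mass `1
/ n^r`. These masses add up to 1, so the complement of the box is null. -/
theorem measureReal_preimage_eq_card_div {Ω : Type*} [MeasurableSpace Ω] {P : Measure Ω}
    [IsProbabilityMeasure P] {r n : ℕ} (hn : 0 < n) {X : Fin r → Ω → ℕ}
    (hmeas : ∀ i, Measurable (X i))
    (hunif : ∀ i, pdf.IsUniform (X i) (Set.Icc 1 n) P Measure.count)
    (hindep : iIndepFun X P) (B : Set (Fin r → ℕ)) [DecidablePred (· ∈ B)] :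
    P.real ((fun ω i => X i ω) ⁻¹' B)
      = (((Fintype.piFinset fun _ : Fin r => Finset.Icc 1 n).filter (· ∈ B)).card : ℝ)
        / (n : ℝ) ^ r := by
  have hn0 : (n : ℝ) ≠ 0 := by exact_mod_cast hn.ne'
  set box := Fintype.piFinset fun _ : Fin r => Finset.Icc 1 n with hbox
  have hm : Measurable fun ω i => X i ω := measurable_pi_lambda _ hmeas
  set ν := P.map fun ω i => X i ω with hν
  have hprob : IsProbabilityMeasure ν := Measure.isProbabilityMeasure_map hm.aemeasurable
  have hpi : ν = Measure.pi fun _ : Fin r => cond Measure.count (Set.Icc 1 n) := by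
    rw [hν, (iIndepFun_iff_map_fun_eq_pi_map fun i => (hmeas i).aemeasurable).1 hindep]
    congr 1
    funext i
    exact hunif i
  have hcount : Measure.count (Set.Icc 1 n) = (n : ENNReal) := by
    rw [← Finset.coe_Icc, Measure.count_apply_finset, Nat.card_Icc, Nat.add_sub_cancel]
  have hcondprob : IsProbabilityMeasure (cond (Measure.count : Measure ℕ) (Set.Icc 1 n)) :=
    cond_isProbabilityMeasure_of_finite (by simp [hcount, hn.ne']) (by simp [hcount])
  have hsing : ∀ x ∈ box, ν.real {x} = 1 / (n : ℝ) ^ r := by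
    intro x hx
    have hone : ∀ i, cond Measure.count (Set.Icc 1 n) {x i} = (n : ENNReal)⁻¹ := fun i => by
      have hxi : Set.Icc 1 n ∩ {x i} = {x i} := by
        refine Set.inter_eq_right.2 (Set.singleton_subset_iff.2 ?_)
        simpa using (Fintype.mem_piFinset.1 hx) i
      rw [cond_apply measurableSet_Icc, hxi, hcount, Measure.count_singleton, mul_one]
    rw [measureReal_def, hpi, Measure.pi_singleton, Finset.prod_congr rfl fun i _ => hone i]
    simp
  have hfin : ∀ T ⊆ box, ν.real T = (T.card : ℝ) / (n : ℝ) ^ r := by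
    intro T hT
    rw [← sum_measureReal_singleton, Finset.sum_congr rfl fun x hx => hsing x (hT hx)]
    rw [Finset.sum_const, nsmul_eq_mul, mul_one_div]
  have hbox1 : ν.real box = 1 := by
    rw [hfin box subset_rfl, hbox, Fintype.card_piFinset]
    simp [hn0]
  have hcompl : ν (boxᶜ : Set (Fin r → ℕ)) = 0 := by
    rw [← measureReal_eq_zero_iff, probReal_compl_eq_one_sub box.measurableSet, hbox1, sub_self]
  rw [← hfin _ (Finset.filter_subset _ _)]
  have : P.real ((fun ω i => X i ω) ⁻¹' B) = ν.real B := by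
    rw [hν, map_measureReal_apply hm (Set.to_countable B).measurableSet]
  rw [this]
  refine measureReal_congr ?_
  have hae : ∀ᵐ x ∂ν, x ∈ box := by
    rw [ae_iff]
    exact hcompl
  filter_upwards [hae] with x hx
  refine propext ⟨fun h => ?_, fun h => ?_⟩
  · exact Finset.mem_coe.2 (Finset.mem_filter.2 ⟨hx, h⟩)
  · exact (Finset.mem_filter.1 (Finset.mem_coe.1 h)).2

/-! ### Common large prime factors -/

open Classical in
/-- Tuples with two coordinates sharing a prime factor larger than `w` are rare. -/
theorem card_box_common_large_prime_le {r : ℕ} (hr : 2 ≤ r) (n : ℕ) {w : ℕ} (hw : 0 < w) :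
    (((Fintype.piFinset fun _ : Fin r => Finset.Icc 1 n).filter fun y =>
      ∃ p, w < p ∧ ∃ i k, i ≠ k ∧ p ∣ y i ∧ p ∣ y k).card : ℝ) ≤ r ^ 2 * (n : ℝ) ^ r / w := by
  set D : ℕ → Finset ℕ := fun p => (Finset.Ioc 0 n).filter (p ∣ ·) with hD
  have hsub : (Fintype.piFinset fun _ : Fin r => Finset.Icc 1 n).filter (fun y =>
      ∃ p, w < p ∧ ∃ i k, i ≠ k ∧ p ∣ y i ∧ p ∣ y k) ⊆
      (Finset.Ioc w n).biUnion fun p => (Finset.univ : Finset (Fin r)).offDiag.biUnion fun q =>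
        (Fintype.piFinset fun _ : Fin r => Finset.Icc 1 n).filter fun y =>
          y q.1 ∈ D p ∧ y q.2 ∈ D p := by
    intro y hy
    obtain ⟨hy, p, hp, i, k, hik, hi, hk⟩ := Finset.mem_filter.1 hy
    have hbox := fun l => Finset.mem_Icc.1 ((Fintype.mem_piFinset.1 hy) l)
    refine Finset.mem_biUnion.2 ⟨p, Finset.mem_Ioc.2 ⟨hp, ?_⟩, Finset.mem_biUnion.2 ⟨(i, k), ?_,
      Finset.mem_filter.2 ⟨hy, ?_, ?_⟩⟩⟩
    · exact (Nat.le_of_dvd (hbox i).1 hi).trans (hbox i).2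
    · simpa using hik
    · exact Finset.mem_filter.2 ⟨Finset.mem_Ioc.2 (hbox i), hi⟩
    · exact Finset.mem_filter.2 ⟨Finset.mem_Ioc.2 (hbox k), hk⟩
  have hone : ∀ p ∈ Finset.Ioc w n, ∀ q ∈ (Finset.univ : Finset (Fin r)).offDiag,
      (((Fintype.piFinset fun _ : Fin r => Finset.Icc 1 n).filter fun y =>
          y q.1 ∈ D p ∧ y q.2 ∈ D p).card : ℝ) ≤ (n : ℝ) ^ r * ((p : ℝ) ^ 2)⁻¹ := by
    intro p hp q hq
    have hp0 : (0 : ℝ) < p := by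
      have := (Finset.mem_Ioc.1 hp).1
      exact_mod_cast hw.trans this
    have hDp : ((D p).card : ℝ) ≤ n / p := by
      rw [hD, Nat.Ioc_filter_dvd_card_eq_div]
      exact Nat.cast_div_le
    have h1 := card_box_filter_mem_mem_le r n (Finset.mem_offDiag.1 hq).2.2 (D p) (D p)
    calc (((Fintype.piFinset fun _ : Fin r => Finset.Icc 1 n).filter fun y =>
          y q.1 ∈ D p ∧ y q.2 ∈ D p).card : ℝ)
        ≤ (D p).card * ((D p).card * (n : ℝ) ^ (r - 2)) := by exact_mod_cast h1
      _ ≤ (n / p) * ((n / p) * (n : ℝ) ^ (r - 2)) := by gcongr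
      _ = (n : ℝ) ^ r * ((p : ℝ) ^ 2)⁻¹ := by
        obtain ⟨m, rfl⟩ : ∃ m, r = m + 2 := ⟨r - 2, by omega⟩
        rw [Nat.add_sub_cancel, pow_add]
        field_simp
  -- Primality of `p` is not needed: the sum over all integers above `w` telescopes to at most `1 /
  -- w`.
  have hsum : ∑ p ∈ Finset.Ioc w n, ((p : ℝ) ^ 2)⁻¹ ≤ 1 / w := by
    rcases le_total w n with h | h
    · refine (sum_Ioc_inv_sq_le_sub hw.ne' h).trans ?_
      rw [one_div]
      have : (0 : ℝ) ≤ (n : ℝ)⁻¹ := by positivity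
      linarith
    · rw [Finset.Ioc_eq_empty_of_le h, Finset.sum_empty]
      positivity
  have hoff : ((Finset.univ : Finset (Fin r)).offDiag.card : ℝ) ≤ r ^ 2 := by
    have : (Finset.univ : Finset (Fin r)).offDiag.card ≤ r ^ 2 := by
      rw [Finset.offDiag_card, Finset.card_univ, Fintype.card_fin, sq]
      exact Nat.sub_le _ _
    exact_mod_cast this
  calc (((Fintype.piFinset fun _ : Fin r => Finset.Icc 1 n).filter fun y =>
      ∃ p, w < p ∧ ∃ i k, i ≠ k ∧ p ∣ y i ∧ p ∣ y k).card : ℝ)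
      ≤ ∑ p ∈ Finset.Ioc w n, ∑ q ∈ (Finset.univ : Finset (Fin r)).offDiag,
        (((Fintype.piFinset fun _ : Fin r => Finset.Icc 1 n).filter fun y =>
          y q.1 ∈ D p ∧ y q.2 ∈ D p).card : ℝ) := by
        have := (Finset.card_le_card hsub).trans (Finset.card_biUnion_le.trans
          (Finset.sum_le_sum fun p _ => Finset.card_biUnion_le))
        exact_mod_cast this
    _ ≤ ∑ p ∈ Finset.Ioc w n, ∑ _q ∈ (Finset.univ : Finset (Fin r)).offDiag,
        (n : ℝ) ^ r * ((p : ℝ) ^ 2)⁻¹ :=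
        Finset.sum_le_sum fun p hp => Finset.sum_le_sum fun q hq => hone p hp q hq
    _ = (Finset.univ : Finset (Fin r)).offDiag.card * ((n : ℝ) ^ r *
          ∑ p ∈ Finset.Ioc w n, ((p : ℝ) ^ 2)⁻¹) := by
        simp only [Finset.sum_const, nsmul_eq_mul, Finset.mul_sum]
    _ ≤ r ^ 2 * ((n : ℝ) ^ r * (1 / w)) := by gcongr
    _ = r ^ 2 * (n : ℝ) ^ r / w := by ring

/-! ### Convergence of the Euler products -/

/-- With `x = 1/p` and `m = r - 1`, Bernoulli's inequality applied to each factor puts the product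
between `1 - m^2 x^2` and `(1 - x^2)^m ≤ 1`. -/
theorem abs_coprimeFactor_sub_one_le {r : ℕ} (hr : 0 < r) (p : Nat.Primes) :
    |coprimeFactor r p - 1| ≤ ((r : ℝ) - 1) ^ 2 * (1 / ((p : ℕ) : ℝ) ^ 2) := by
  have hp : (1 : ℝ) ≤ ((p : ℕ) : ℝ) := by exact_mod_cast p.2.one_lt.le
  obtain ⟨m, rfl⟩ : ∃ m, r = m + 1 := ⟨r - 1, by omega⟩
  set x : ℝ := 1 / ((p : ℕ) : ℝ) with hx
  have hx0 : 0 ≤ x := by positivity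
  have hx1 : x ≤ 1 := (div_le_one (by linarith)).2 hp
  have hm : (0 : ℝ) ≤ m := Nat.cast_nonneg m
  have hfac : coprimeFactor (m + 1) p = (1 - x) ^ m * (1 + m * x) := by
    rw [coprimeFactor]
    push_cast
    rw [hx]
    ring
  have hsq : 1 / ((p : ℕ) : ℝ) ^ 2 = x ^ 2 := by rw [hx]; ring
  have hlow : 1 - m * x ≤ (1 - x) ^ m := by
    have := one_add_mul_le_pow (a := -x) (by linarith) m
    simpa [sub_eq_add_neg] using this
  have hup : 1 + m * x ≤ (1 + x) ^ m := one_add_mul_le_pow (by linarith) m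
  have hle : (1 - x) ^ m * (1 + m * x) ≤ 1 := by
    calc (1 - x) ^ m * (1 + m * x) ≤ (1 - x) ^ m * (1 + x) ^ m :=
          mul_le_mul_of_nonneg_left hup (pow_nonneg (by linarith) m)
      _ = (1 - x ^ 2) ^ m := by rw [← mul_pow]; ring
      _ ≤ 1 := pow_le_one₀ (by nlinarith) (by nlinarith)
  have hge : (1 - m * x) * (1 + m * x) ≤ (1 - x) ^ m * (1 + m * x) :=
    mul_le_mul_of_nonneg_right hlow (by positivity)
  rw [hfac, hsq]
  push_cast
  rw [add_sub_cancel_right, abs_le]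
  constructor
  · nlinarith
  · have : 0 ≤ (m : ℝ) ^ 2 * x ^ 2 := by positivity
    linarith

theorem multipliable_coprimeFactor {r : ℕ} (hr : 0 < r) : Multipliable (coprimeFactor r) := by
  have hs : Summable fun p : Nat.Primes => ((r : ℝ) - 1) ^ 2 * (1 / ((p : ℕ) : ℝ) ^ 2) :=
    ((Real.summable_one_div_nat_pow.2 one_lt_two).comp_injective
      (i := fun p : Nat.Primes => (p : ℕ)) Subtype.coe_injective).mul_left _
  have h := multipliable_one_add_of_summable (f := fun p => coprimeFactor r p - 1)
    (hs.of_nonneg_of_le (fun _ => norm_nonneg _) fun p => abs_coprimeFactor_sub_one_le hr p)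
  simpa using h

/-- The primes up to `w`. -/
def primesUpTo (w : ℕ) : Finset Nat.Primes := (Finset.range (w + 1)).subtype Nat.Prime

theorem mem_primesUpTo {w : ℕ} {p : Nat.Primes} : p ∈ primesUpTo w ↔ (p : ℕ) ≤ w := by
  exact Finset.mem_subtype.trans (Finset.mem_range.trans Nat.lt_succ_iff)

theorem tendsto_primesUpTo : Tendsto primesUpTo atTop atTop := by
  refine tendsto_atTop_finset_of_monotone (fun v w hvw p hp => ?_) fun p => ⟨p, ?_⟩
  · exact mem_primesUpTo.2 ((mem_primesUpTo.1 hp).trans hvw)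
  · exact mem_primesUpTo.2 le_rfl

theorem tendsto_prod_one_sub_inv_zeta {r : ℕ} (hr : 2 ≤ r) :
    Tendsto (fun w => ∏ p ∈ primesUpTo w, (1 - 1 / ((p : ℕ) : ℝ) ^ r)) atTop
      (nhds (1 / (riemannZeta (r : ℂ)).re)) := by
  have hre : 1 < ((r : ℂ)).re := by
    rw [Complex.natCast_re]; exact_mod_cast hr
  have h := ((Complex.continuous_re.tendsto _).comp
    ((riemannZeta_eulerProduct_hasProd hre).comp tendsto_primesUpTo))
  have hreal : Tendsto (fun w => ∏ p ∈ primesUpTo w, (1 - 1 / ((p : ℕ) : ℝ) ^ r)⁻¹) atTop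
      (nhds (riemannZeta (r : ℂ)).re) := by
    refine h.congr fun w => ?_
    have : ∏ p ∈ primesUpTo w, (1 - ((p : ℕ) : ℂ) ^ (-(r : ℂ)))⁻¹
        = ((∏ p ∈ primesUpTo w, (1 - 1 / ((p : ℕ) : ℝ) ^ r)⁻¹ : ℝ) : ℂ) := by
      push_cast
      refine Finset.prod_congr rfl fun p _ => ?_
      rw [Complex.cpow_neg, Complex.cpow_natCast, one_div]
    simp only [Function.comp_apply]
    rw [this, Complex.ofReal_re]
  -- Every Euler factor is at least 1, so the limit is nonzero and may be inverted.
  have hone : 1 ≤ (riemannZeta (r : ℂ)).re := by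
    refine ge_of_tendsto' hreal fun w => Finset.one_le_prod fun p _ => ?_
    have hp : (1 : ℝ) < ((p : ℕ) : ℝ) ^ r :=
      one_lt_pow₀ (by exact_mod_cast p.2.one_lt) (by omega)
    have h1 : 1 / ((p : ℕ) : ℝ) ^ r < 1 := (div_lt_one (by linarith)).2 hp
    have h2 : 0 ≤ 1 / ((p : ℕ) : ℝ) ^ r := by positivity
    exact (one_le_inv₀ (by linarith)).2 (by linarith)
  have hinv := hreal.inv₀ (by linarith)
  rw [one_div]
  refine hinv.congr fun w => ?_
  rw [Finset.prod_inv_distrib, inv_inv]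

/-! ### Only finitely many common divisors contribute -/

theorem boundTerm_eq_zero {r : ℕ} {t : ℝ} {j : ℕ+} (h : 1 ≤ t * ((j : ℕ) : ℝ) ^ (r - 1)) :
    boundTerm r t j = 0 := by
  have : hyperbolicRegion r (t * ((j : ℕ) : ℝ) ^ (r - 1))
      = {x : Fin r → ℝ | ∀ i, 0 ≤ x i ∧ x i ≤ 1} := by
    refine Set.Subset.antisymm (fun x hx => hx.1) fun x hx => ⟨hx, le_trans ?_ h⟩
    exact Finset.prod_le_one (fun i _ => (hx i).1) fun i _ => (hx i).2
  rw [boundTerm, OmegaVol, this, measureReal_def, volume_unitCube]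
  simp

theorem exists_forall_lt_one_le {r : ℕ} (hr : 2 ≤ r) {t : ℝ} (ht : 0 < t) :
    ∃ J : ℕ+, ∀ j : ℕ+, j ∉ Finset.Icc 1 J → 1 ≤ t * ((j : ℕ) : ℝ) ^ (r - 1) := by
  obtain ⟨m, hm⟩ := exists_nat_ge (1 / t)
  refine ⟨m.succPNat, fun j hj => ?_⟩
  have hlt : m.succPNat < j := by
    by_contra hle
    exact hj (Finset.mem_Icc.2 ⟨one_le, not_lt.1 hle⟩)
  have hmj : m ≤ (j : ℕ) := by
    have : m + 1 < (j : ℕ) := hlt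
    omega
  have hj1 : (1 : ℝ) ≤ ((j : ℕ) : ℝ) := by exact_mod_cast j.pos
  calc (1 : ℝ) = t * (1 / t) := by field_simp
    _ ≤ t * ((j : ℕ) : ℝ) := by
      refine mul_le_mul_of_nonneg_left (hm.trans ?_) ht.le
      exact_mod_cast hmj
    _ ≤ t * ((j : ℕ) : ℝ) ^ (r - 1) := by
      refine mul_le_mul_of_nonneg_left ?_ ht.le
      exact le_self_pow₀ hj1 (by omega)

theorem largeMultiples_eq_empty {r j n : ℕ} {s : ℝ} (hs : 1 ≤ s) :
    largeMultiples r j n s = ∅ := by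
  refine Finset.eq_empty_of_forall_notMem fun y hy => ?_
  obtain ⟨-, h2, h3⟩ := mem_largeMultiples.1 hy
  have h4 : ∏ i, ((j * y i : ℕ) : ℝ) ≤ ∏ _i : Fin r, (n : ℝ) :=
    Finset.prod_le_prod (fun i _ => by positivity) fun i _ => by exact_mod_cast h2 i
  rw [Finset.prod_const, Finset.card_univ, Fintype.card_fin] at h4
  have h5 : (0 : ℝ) ≤ (n : ℝ) ^ r := by positivity
  nlinarith

/-! ### Common divisors, lcm and coprimality -/

theorem prod_mul_eq {r : ℕ} (hr : 0 < r) (j : ℕ) (y : Fin r → ℕ) :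
    ∏ i, j * y i = j ^ (r - 1) * (j * ∏ i, y i) := by
  rw [Finset.prod_mul_distrib, Finset.prod_const, Finset.card_univ, Fintype.card_fin, ← mul_assoc,
    ← pow_succ, Nat.sub_add_cancel hr]

theorem lcm_mul_eq_mul_prod {r : ℕ} (hr : 0 < r) {j : ℕ} (hj : 0 < j) {y : Fin r → ℕ}
    (hy : Pairwise (Function.onFun Nat.Coprime y)) :
    Finset.univ.lcm (fun i => j * y i) = j * ∏ i, y i := by
  refine Nat.dvd_antisymm (Finset.lcm_dvd fun i _ =>
    Nat.mul_dvd_mul_left j (Finset.dvd_prod_of_mem y (Finset.mem_univ i))) ?_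
  have hd : ∀ i, j * y i ∣ Finset.univ.lcm (fun i => j * y i) :=
    fun i => Finset.dvd_lcm (f := fun i => j * y i) (Finset.mem_univ i)
  -- As `r > 0`, the factor `j` divides the lcm. Cancelling it leaves a common multiple `q` of the
  -- pairwise coprime `y i`.
  obtain ⟨q, hq⟩ := (Dvd.intro _ rfl).trans (hd ⟨0, hr⟩)
  rw [hq] at hd ⊢
  refine Nat.mul_dvd_mul_left j ?_
  rw [← Finset.lcm_eq_prod (hy.set_pairwise _)]
  exact Finset.lcm_dvd fun i _ => (Nat.mul_dvd_mul_iff_left hj).1 (hd i)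

open Classical in
/-- The tuples in `[1, n]^r` whose least common multiple exceeds `t * n ^ r`. -/
noncomputable def largeLcm (r n : ℕ) (t : ℝ) : Finset (Fin r → ℕ) :=
  (Fintype.piFinset fun _ => Finset.Icc 1 n).filter fun x =>
    x ∈ {x : Fin r → ℕ | t * (n : ℝ) ^ r < ((Finset.univ.lcm fun i => x i : ℕ) : ℝ)}

theorem mem_largeLcm {r n : ℕ} {t : ℝ} {x : Fin r → ℕ} :
    x ∈ largeLcm r n t ↔ (∀ i, 1 ≤ x i ∧ x i ≤ n) ∧
      t * (n : ℝ) ^ r < ((Finset.univ.lcm fun i => x i : ℕ) : ℝ) := by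
  simp [largeLcm]

/-- The product of the `j * y i` carries `j^r`, the upper bound for the lcm only one `j`. The
surplus is the `j^(r-1)` in the argument of `Ω_r`. -/
theorem mul_prod_lt_iff {r n j : ℕ} (hr : 0 < r) (hj : 0 < j) (t : ℝ) (y : Fin r → ℕ) :
    t * (j : ℝ) ^ (r - 1) * (n : ℝ) ^ r < ∏ i, ((j * y i : ℕ) : ℝ) ↔
      t * (n : ℝ) ^ r < ((j * ∏ i, y i : ℕ) : ℝ) := by
  have hj0 : (0 : ℝ) < (j : ℝ) ^ (r - 1) := by positivity
  have h : ∏ i, ((j * y i : ℕ) : ℝ) = (j : ℝ) ^ (r - 1) * ((j * ∏ i, y i : ℕ) : ℝ) := by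
    rw [← Nat.cast_prod, prod_mul_eq hr]
    push_cast
    ring
  rw [h, mul_assoc, mul_left_comm, mul_lt_mul_iff_right₀ hj0]

open Classical in
theorem card_largeLcm_le {r n : ℕ} (hr : 0 < r) {t : ℝ} {S : Finset ℕ+}
    (hS : ∀ j ∉ S, 1 ≤ t * ((j : ℕ) : ℝ) ^ (r - 1)) :
    (largeLcm r n t).card ≤ ∑ j ∈ S, ((largeMultiples r j n (t * ((j : ℕ) : ℝ) ^ (r - 1))).filter
      fun y => Finset.univ.gcd y = 1).card := by
  have hne : (Finset.univ : Finset (Fin r)).Nonempty := ⟨⟨0, hr⟩, Finset.mem_univ _⟩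
  have hsub : largeLcm r n t ⊆ S.biUnion fun j =>
      ((largeMultiples r j n (t * ((j : ℕ) : ℝ) ^ (r - 1))).filter
        fun y => Finset.univ.gcd y = 1).image fun y i => (j : ℕ) * y i := by
    intro x hx
    obtain ⟨hx1, hx2⟩ := mem_largeLcm.1 hx
    obtain ⟨y, hxy, hy⟩ := Finset.extract_gcd x hne
    have hg : 0 < Finset.univ.gcd x := by
      refine Nat.pos_of_ne_zero fun h0 => ?_
      have h1 := hxy ⟨0, hr⟩ (Finset.mem_univ _)
      have h2 := (hx1 ⟨0, hr⟩).1
      rw [h0, zero_mul] at h1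
      omega
    set g : ℕ+ := ⟨Finset.univ.gcd x, hg⟩ with hgdef
    have hxy' : ∀ i, x i = (g : ℕ) * y i := fun i => hxy i (Finset.mem_univ i)
    have hmem : y ∈ largeMultiples r g n (t * ((g : ℕ) : ℝ) ^ (r - 1)) := by
      have hpos : ∀ i, 1 ≤ y i := fun i => by
        refine Nat.pos_of_ne_zero fun h0 => ?_
        have h1 := hxy' i
        have h2 := (hx1 i).1
        rw [h0, mul_zero] at h1
        omega
      have hle : ∀ i, (g : ℕ) * y i ≤ n := fun i => by rw [← hxy']; exact (hx1 i).2
      refine mem_largeMultiples.2 ⟨fun i => ⟨hpos i, ?_⟩, hle, ?_⟩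
      · exact (Nat.le_mul_of_pos_left _ g.pos).trans (hle i)
      · rw [mul_prod_lt_iff hr g.pos]
        refine hx2.trans_le ?_
        have hpr : 0 < (g : ℕ) * ∏ i, y i :=
          Nat.mul_pos g.pos (Finset.prod_pos fun i _ => hpos i)
        refine Nat.cast_le.2 (Nat.le_of_dvd hpr (Finset.lcm_dvd fun i _ => ?_))
        rw [hxy']
        exact Nat.mul_dvd_mul_left _ (Finset.dvd_prod_of_mem y (Finset.mem_univ i))
    have hgS : g ∈ S := by
      by_contra hgS
      rw [largeMultiples_eq_empty (hS g hgS)] at hmem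
      exact absurd hmem (Finset.notMem_empty _)
    refine Finset.mem_biUnion.2 ⟨g, hgS, Finset.mem_image.2 ⟨y, Finset.mem_filter.2 ⟨hmem, hy⟩, ?_⟩⟩
    funext i
    exact (hxy' i).symm
  exact (Finset.card_le_card hsub).trans (Finset.card_biUnion_le.trans
    (Finset.sum_le_sum fun j _ => Finset.card_image_le))

open Classical in
theorem le_card_largeLcm {r n : ℕ} (hr : 2 ≤ r) {t : ℝ} (S : Finset ℕ+) :
    ∑ j ∈ S, ((largeMultiples r j n (t * ((j : ℕ) : ℝ) ^ (r - 1))).filter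
      fun y => Pairwise (Function.onFun Nat.Coprime y)).card ≤ (largeLcm r n t).card := by
  have hr0 : 0 < r := by omega
  -- The first two coordinates of `j y` already determine `j`, so the families for different `j` are
  -- disjoint.
  have hgcd : ∀ (j : ℕ) (y : Fin r → ℕ), Pairwise (Function.onFun Nat.Coprime y) →
      Nat.gcd (j * y ⟨0, hr0⟩) (j * y ⟨1, hr⟩) = j := fun j y hy => by
    rw [Nat.gcd_mul_left, Nat.Coprime.gcd_eq_one, mul_one]
    exact hy (by simp)
  have himg : ∀ j : ℕ+, ((largeMultiples r j n (t * ((j : ℕ) : ℝ) ^ (r - 1))).filter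
      fun y => Pairwise (Function.onFun Nat.Coprime y)).card
      = (((largeMultiples r j n (t * ((j : ℕ) : ℝ) ^ (r - 1))).filter
      fun y => Pairwise (Function.onFun Nat.Coprime y)).image fun y i => (j : ℕ) * y i).card := by
    intro j
    refine (Finset.card_image_of_injective _ fun y z hyz => ?_).symm
    funext i
    exact Nat.eq_of_mul_eq_mul_left j.pos (congrFun hyz i)
  rw [Finset.sum_congr rfl fun j _ => himg j, ← Finset.card_biUnion]
  · refine Finset.card_le_card fun x hx => ?_
    obtain ⟨j, -, hx⟩ := Finset.mem_biUnion.1 hx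
    obtain ⟨y, hy, rfl⟩ := Finset.mem_image.1 hx
    obtain ⟨hy, hc⟩ := Finset.mem_filter.1 hy
    obtain ⟨h1, h2, h3⟩ := mem_largeMultiples.1 hy
    refine mem_largeLcm.2 ⟨fun i => ⟨Nat.mul_pos j.pos (h1 i).1, h2 i⟩, ?_⟩
    rw [lcm_mul_eq_mul_prod hr0 j.pos hc]
    exact (mul_prod_lt_iff hr0 j.pos t y).1 h3
  · intro j _ k _ hjk
    refine Finset.disjoint_left.2 fun x hxj hxk => hjk ?_
    obtain ⟨y, hy, rfl⟩ := Finset.mem_image.1 hxj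
    obtain ⟨z, hz, hyz⟩ := Finset.mem_image.1 hxk
    have h1 := hgcd j y (Finset.mem_filter.1 hy).2
    have h2 := hgcd k z (Finset.mem_filter.1 hz).2
    have e0 := congrFun hyz ⟨0, hr0⟩
    have e1 := congrFun hyz ⟨1, hr⟩
    rw [e0, e1, h1] at h2
    exact PNat.eq h2

open Classical in
theorem card_filter_gcd_eq_one_le {r : ℕ} (L : Finset (Fin r → ℕ)) (Q : Finset Nat.Primes) :
    (L.filter fun y => Finset.univ.gcd y = 1).card ≤ (L.filter fun y => ∀ p ∈ Q,
      (fun i => (y i : ZMod (p : ℕ))) ≠ 0).card := by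
  refine Finset.card_le_card (Finset.monotone_filter_right L fun y _ hy p _ h0 => ?_)
  refine p.2.one_lt.ne' (Nat.dvd_one.1 ?_)
  rw [← hy]
  exact Finset.dvd_gcd fun i _ => (ZMod.natCast_eq_zero_iff _ _).1 (congrFun h0 i)

open Classical in
-- A pair that is not coprime shares a prime. If no prime up to `w` divides two coordinates, that
-- prime exceeds `w`, and such tuples are rare.
theorem card_filter_primesUpTo_le {r : ℕ} (hr : 2 ≤ r) {n w : ℕ} (hw : 0 < w)
    {L : Finset (Fin r → ℕ)} (hL : L ⊆ Fintype.piFinset fun _ : Fin r => Finset.Icc 1 n) :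
    ((L.filter fun y => ∀ p ∈ primesUpTo w, ∀ i k, i ≠ k →
      (y i : ZMod (p : ℕ)) ≠ 0 ∨ (y k : ZMod (p : ℕ)) ≠ 0).card : ℝ)
      ≤ (L.filter fun y => Pairwise (Function.onFun Nat.Coprime y)).card
        + r ^ 2 * (n : ℝ) ^ r / w := by
  refine le_trans ?_ (add_le_add_right (card_box_common_large_prime_le hr n hw) _)
  have hsub : (L.filter fun y => ∀ p ∈ primesUpTo w, ∀ i k, i ≠ k →
      (y i : ZMod (p : ℕ)) ≠ 0 ∨ (y k : ZMod (p : ℕ)) ≠ 0)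
      ⊆ (L.filter fun y => Pairwise (Function.onFun Nat.Coprime y)) ∪
        ((Fintype.piFinset fun _ : Fin r => Finset.Icc 1 n).filter fun y =>
          ∃ p, w < p ∧ ∃ i k, i ≠ k ∧ p ∣ y i ∧ p ∣ y k) := by
    intro y hy
    obtain ⟨hy, hloc⟩ := Finset.mem_filter.1 hy
    by_cases hc : Pairwise (Function.onFun Nat.Coprime y)
    · exact Finset.mem_union_left _ (Finset.mem_filter.2 ⟨hy, hc⟩)
    · refine Finset.mem_union_right _ (Finset.mem_filter.2 ⟨hL hy, ?_⟩)
      simp only [Pairwise, not_forall] at hc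
      obtain ⟨i, k, hik, hc⟩ := hc
      obtain ⟨p, hp, hpi, hpk⟩ := Nat.Prime.not_coprime_iff_dvd.1 hc
      refine ⟨p, ?_, i, k, hik, hpi, hpk⟩
      by_contra hle
      have := hloc ⟨p, hp⟩ (mem_primesUpTo.2 (not_lt.1 hle)) i k hik
      rcases this with h | h
      · exact h ((ZMod.natCast_eq_zero_iff _ _).2 hpi)
      · exact h ((ZMod.natCast_eq_zero_iff _ _).2 hpk)
  exact_mod_cast (Finset.card_le_card hsub).trans (Finset.card_union_le _ _)

/-! ### Passage to the limit -/

theorem measureReal_lcmEvent {Ω : Type*} [MeasurableSpace Ω] {P : Measure Ω}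
    [IsProbabilityMeasure P] {r n : ℕ} (hn : 0 < n) {X : Fin r → Ω → ℕ}
    (hmeas : ∀ i, Measurable (X i))
    (hunif : ∀ i, pdf.IsUniform (X i) (Set.Icc 1 n) P Measure.count)
    (hindep : iIndepFun X P) (t : ℝ) :
    P.real (lcmEvent X t n) = 1 - ((largeLcm r n t).card : ℝ) / (n : ℝ) ^ r := by
  classical
  set B : Set (Fin r → ℕ) :=
    {x | t * (n : ℝ) ^ r < ((Finset.univ.lcm fun i => x i : ℕ) : ℝ)} with hB
  have hm : Measurable fun ω i => X i ω := measurable_pi_lambda _ hmeas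
  have hcompl : lcmEvent X t n = ((fun ω i => X i ω) ⁻¹' B)ᶜ := by
    ext ω
    change ((Finset.univ.lcm fun i => X i ω : ℕ) : ℝ) ≤ t * (n : ℝ) ^ r ↔
      ¬t * (n : ℝ) ^ r < ((Finset.univ.lcm fun i => X i ω : ℕ) : ℝ)
    exact not_lt.symm
  rw [hcompl, probReal_compl_eq_one_sub (hm (Set.to_countable B).measurableSet),
    measureReal_preimage_eq_card_div hn hmeas hunif hindep B]
  rw [largeLcm]

/-- In `ℝ` comparing lower limits requires that `u` not escape to infinity, which the bound `u n ≤
1` ensures. -/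
theorem liminf_ge_of_tendsto {u v : ℕ → ℝ} {a : ℝ} (hv : Tendsto v atTop (nhds a))
    (hu : ∀ n, u n ≤ 1) (hle : ∀ᶠ n in atTop, v n ≤ u n) : a ≤ liminf u atTop := by
  rw [← hv.liminf_eq]
  exact liminf_le_liminf hle hv.isBoundedUnder_ge
    (isCoboundedUnder_ge_of_le atTop hu)

theorem limsup_le_of_tendsto {u v : ℕ → ℝ} {a : ℝ} (hv : Tendsto v atTop (nhds a))
    (hu : ∀ n, 0 ≤ u n) (hle : ∀ᶠ n in atTop, u n ≤ v n) : limsup u atTop ≤ a := by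
  rw [← hv.limsup_eq]
  exact limsup_le_limsup hle (isCoboundedUnder_le_of_le atTop hu) hv.isBoundedUnder_le

open Classical in
/-- Summing over the common divisor `j`, with local conditions imposed at the primes of `Q`. -/
theorem tendsto_sum_card_filter_primes {r : ℕ} (hr : 0 < r) {t : ℝ} (ht : 0 < t)
    (S : Finset ℕ+) (Q : Finset Nat.Primes)
    (A : ∀ p : Nat.Primes, Finset (Fin r → ZMod (p : ℕ))) :
    Tendsto (fun n : ℕ => ∑ j ∈ S, (((largeMultiples r j n
        (t * ((j : ℕ) : ℝ) ^ (r - 1))).filter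
          fun y => ∀ p ∈ Q, (fun i => (y i : ZMod (p : ℕ))) ∈ A p).card : ℝ) / (n : ℝ) ^ r) atTop
      (nhds ((∏ p ∈ Q, ((A p).card : ℝ) / ((p : ℕ) : ℝ) ^ r) * ∑ j ∈ S, boundTerm r t j)) := by
  rw [Finset.mul_sum]
  refine tendsto_finsetSum S fun j _ => ?_
  have hj : (0 : ℝ) < ((j : ℕ) : ℝ) := by exact_mod_cast j.pos
  exact tendsto_card_largeMultiples_filter_primes hr j.pos (by positivity) Q A

theorem theorem1 (r : ℕ) (hr : 3 ≤ r)
    {S : ℕ → Type*} [∀ n, MeasurableSpace (S n)]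
    (P : ∀ n, Measure (S n)) [∀ n, IsProbabilityMeasure (P n)]
    (X : ∀ n, Fin r → S n → ℕ)
    (hmeas : ∀ n, 2 ≤ n → ∀ i, Measurable (X n i))
    (hunif : ∀ n, 2 ≤ n → ∀ i,
      pdf.IsUniform (X n i) (Set.Icc 1 n) (P n) Measure.count)
    (hindep : ∀ n, 2 ≤ n → iIndepFun (X n) (P n))
    (t : ℝ) (ht0 : 0 < t) (ht1 : t ≤ 1) :
    Summable (boundTerm r t) ∧
    Multipliable (coprimeFactor r) ∧
    1 - 1 / (riemannZeta (r : ℂ)).re * ∑' j : ℕ+, boundTerm r t j ≤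
      liminf (fun n : ℕ => (P n).real (lcmEvent (X n) t n)) atTop ∧
    limsup (fun n : ℕ => (P n).real (lcmEvent (X n) t n)) atTop ≤
      1 - coprimeConst r * ∑' j : ℕ+, boundTerm r t j := by
  classical
  have hr0 : 0 < r := by omega
  have hr2 : 2 ≤ r := by omega
  have hprime : ∀ p : Nat.Primes, Fact (p : ℕ).Prime := fun p => ⟨p.2⟩
  obtain ⟨J, hJ⟩ := exists_forall_lt_one_le hr2 ht0
  set I : Finset ℕ+ := Finset.Icc 1 J
  have hzero : ∀ j ∉ I, boundTerm r t j = 0 := fun j hj => boundTerm_eq_zero (hJ j hj)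
  have hprob : ∀ n, 2 ≤ n → (P n).real (lcmEvent (X n) t n)
      = 1 - ((largeLcm r n t).card : ℝ) / (n : ℝ) ^ r := fun n hn =>
    measureReal_lcmEvent (by omega) (hmeas n hn) (hunif n hn) (hindep n hn) t
  refine ⟨summable_of_ne_finset_zero hzero, multipliable_coprimeFactor hr0, ?_, ?_⟩
  · rw [tsum_eq_sum hzero]
    -- It suffices to prove the bound with the product over primes up to a fixed `w`, and then let
    -- `w → ∞`.
    refine le_of_tendsto' (((tendsto_prod_one_sub_inv_zeta hr2).mul_const _).const_sub 1)
      fun w => ?_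
    have hlim := (tendsto_sum_card_filter_primes hr0 ht0 I (primesUpTo w)
      fun p => Finset.univ.filter fun a => a ≠ 0).const_sub 1
    have hcard : ∀ p : Nat.Primes, (((Finset.univ.filter
        fun a : Fin r → ZMod (p : ℕ) => a ≠ 0).card : ℝ)) / ((p : ℕ) : ℝ) ^ r
        = 1 - 1 / ((p : ℕ) : ℝ) ^ r := fun p => by
      have hp : (0 : ℝ) < ((p : ℕ) : ℝ) := by exact_mod_cast p.2.pos
      have h1 : 1 ≤ (p : ℕ) ^ r := Nat.one_le_pow _ _ p.2.pos
      have h2 : (Finset.univ.filter fun a : Fin r → ZMod (p : ℕ) => a ≠ 0).card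
          = (p : ℕ) ^ r - 1 := by
        rw [← card_ne_zero_residues r (p : ℕ)]
      rw [h2, Nat.cast_sub h1, Nat.cast_pow, Nat.cast_one, sub_div, div_self (by positivity)]
    rw [Finset.prod_congr rfl fun p _ => hcard p] at hlim
    refine liminf_ge_of_tendsto hlim (fun n => measureReal_le_one) ?_
    filter_upwards [eventually_ge_atTop 2] with n hn
    rw [hprob n hn, ← Finset.sum_div]
    refine sub_le_sub_left (div_le_div_of_nonneg_right ?_ (by positivity)) 1
    rw [← Nat.cast_sum]
    refine Nat.cast_le.2 ((card_largeLcm_le hr0 hJ).trans (Finset.sum_le_sum fun j _ => ?_))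
    refine (card_filter_gcd_eq_one_le _ (primesUpTo w)).trans_eq ?_
    congr 1
    refine Finset.filter_congr fun y _ => ?_
    simp only [Finset.mem_filter, Finset.mem_univ, true_and]
  · rw [tsum_eq_sum hzero]
    have hT : Tendsto (fun w => ∏ p ∈ primesUpTo w, coprimeFactor r p) atTop
        (nhds (coprimeConst r)) :=
      (multipliable_coprimeFactor hr0).hasProd.comp tendsto_primesUpTo
    -- Each of the `I.card` values of `j` loses a proportion at most `r^2 / w` to primes above `w`.
    have herr : Tendsto (fun w : ℕ => (I.card * r ^ 2 : ℝ) / w) atTop (nhds 0) :=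
      tendsto_const_div_atTop_nhds_zero_nat _
    have hbound := ((hT.mul_const (∑ j ∈ I, boundTerm r t j)).sub herr).const_sub 1
    rw [sub_zero] at hbound
    refine ge_of_tendsto hbound ?_
    filter_upwards [eventually_ge_atTop 1] with w hw
    have hlim := ((tendsto_sum_card_filter_primes hr0 ht0 I (primesUpTo w)
      fun p => Finset.univ.filter fun a => ∀ i k, i ≠ k → a i ≠ 0 ∨ a k ≠ 0).sub_const
        ((I.card * r ^ 2 : ℝ) / w)).const_sub 1
    rw [Finset.prod_congr rfl fun p _ => card_pairwise_ne_zero_residues_div hr0 p] at hlim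
    refine limsup_le_of_tendsto hlim (fun n => measureReal_nonneg) ?_
    filter_upwards [eventually_ge_atTop 2] with n hn
    have hn0 : (0 : ℝ) < (n : ℝ) ^ r := by
      have : (0 : ℝ) < n := by exact_mod_cast (by omega : 0 < n)
      positivity
    rw [hprob n hn, ← Finset.sum_div]
    refine sub_le_sub_left ?_ 1
    rw [sub_le_iff_le_add, div_le_iff₀ hn0, add_mul, div_mul_cancel₀ _ hn0.ne']
    have hmain : ∀ j ∈ I, (((largeMultiples r j n (t * ((j : ℕ) : ℝ) ^ (r - 1))).filter
          fun y => ∀ p ∈ primesUpTo w, (fun i => (y i : ZMod (p : ℕ))) ∈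
            Finset.univ.filter fun a : Fin r → ZMod (p : ℕ) =>
              ∀ i k, i ≠ k → a i ≠ 0 ∨ a k ≠ 0).card : ℝ)
        ≤ (((largeMultiples r j n (t * ((j : ℕ) : ℝ) ^ (r - 1))).filter
          fun y => Pairwise (Function.onFun Nat.Coprime y)).card : ℝ)
          + r ^ 2 * (n : ℝ) ^ r / w := fun j _ => by
      refine le_trans (le_of_eq ?_) (card_filter_primesUpTo_le hr2 hw (Finset.filter_subset _ _))
      congr 2
      refine Finset.filter_congr fun y _ => ?_
      simp only [Finset.mem_filter, Finset.mem_univ, true_and]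
    refine (Finset.sum_le_sum hmain).trans ?_
    rw [Finset.sum_add_distrib, Finset.sum_const, nsmul_eq_mul, ← Nat.cast_sum]
    refine add_le_add (Nat.cast_le.2 (le_card_largeLcm hr2 I)) (le_of_eq ?_)
    ring
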